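/- Write $\langle y\rangle=\sqrt{1+y^2}$. Let $k\ge 2$ be an integer and let $l\ge 1$, $L>0$ and $C_0$ be real numbers. Let $u_0:[0,\infty)\to\mathbb{R}$ satisfy $u_0(y)>0$ for $y>0$ and $u_0'(0)>0$. Call $(u,v)$ a solution on $[0,L]$ with initial data $u_0$ if all derivatives $\partial_x^\alpha\partial_y^\beta u$ with $2\alpha+\beta\le 2k$ and $\partial_x^\alpha\partial_y^\beta v$ with $2\alpha+\beta\le 2k-1$ exist and are continuous on $[0,L]\times[0,\infty)$, and $$u\,\partial_x u+v\,\partial_y u-\partial_y^2u+u-1=0,\qquad \partial_xu+\partial_yv=0\qquad\text{on }[0,L]\times[0,\infty),$$ $$u|_{y=0}=v|_{y=0}=0,\qquad \lim_{y\to\infty}u(x,y)=1\ \text{ for all } x\in[0,L],\qquad u|_{x=0}=u_0 .$$ Say that $(u,v)$ satisfies the regularity estimate with constant $C_0$ if, with $\partial_y b:=1-u$, $$\|\partial_x^\alpha\partial_y^\beta u\,\langle y\rangle^l\|_{L^\infty_xL^\infty_y}+\|\partial_x^\gamma v\,\langle y\rangle^{l-1}\|_{L^\infty_xL^\infty_y}+\|\partial_x^\alpha\partial_y^{\beta+1}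 b\,\langle y\rangle^l\|_{L^\infty_xL^\infty_y}\le C_0$$ for all integers $\alpha,\beta,\gamma\ge0$ with $0<2\alpha+\beta\le 2k$ and $\gamma\le k-1$, the norms being taken over $[0,L]\times[0,\infty)$. Then there is a constant $C>0$, depending only on $k,l,L,C_0$ and $u_0$, such that the following holds for any two solutions $(u_1,v_1)$, $(u_2,v_2)$ on $[0,L]$ with the same initial data $u_0$ that both satisfy the regularity estimate with constant $C_0$. One has $u_2>0$ on $[0,L]\times(0,\infty)$, and the quotient $\widehat q:=\dfrac{v_2-v_1}{u_2}$ satisfies, for every $x\in(0,L]$, $$\|(u_2\partial_y\widehat q)(x)\|_{L^2_y}^2+\int_0^x\|(\sqrt{u_2}\,\partial_y^2\widehat q)(\tau)\|_{L^2_y}^2\,d\tau+\int_0^x\|(\sqrt{u_2}\,\partial_y\widehat q)(\tau)\|_{L^2_y}^2\,d\tau\le C\int_0^x\|(u_2\partial_y\widehat q)(\tau)\|_{L^2_y}^2\,d\tau<\infty .$$ Moreover, the solution is unique: $u_1=u_2$ and $v_1=v_2$ on $[0,L]\times[0,\infty)$. -/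

import Mathlib

open MeasureTheory Set Filter Topology
open scoped ENNReal

noncomputable section

namespace PrandtlHartmann

/-- The partial derivative in `x` of a function on the strip `[0, L] × [0, ∞)`
(one-sided at `x = 0` and `x = L`). -/
def dX (L : ℝ) (f : ℝ → ℝ → ℝ) : ℝ → ℝ → ℝ :=
  fun x y => derivWithin (fun s => f s y) (Icc 0 L) x

/-- The partial derivative in `y` of a function on `[0, L] × [0, ∞)` (one-sided at `y = 0`). -/
def dY (f : ℝ → ℝ → ℝ) : ℝ → ℝ → ℝ :=
  fun x y => derivWithin (f x) (Ici 0) y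

/-- The mixed derivative `∂_x^α ∂_y^β f`. -/
def pd (L : ℝ) (α β : ℕ) (f : ℝ → ℝ → ℝ) : ℝ → ℝ → ℝ :=
  (dX L)^[α] (dY^[β] f)

/-- `f` is of class `C^m` on the closed strip `[0, L] × [0, ∞)` in the parabolic scaling, where
`∂_x` counts twice: every `∂_x^α ∂_y^β f` with `2 α + β ≤ m` exists in the classical sense (in
whichever order the derivatives are taken) and is continuous up to the boundary. -/
structure ParabolicRegular (L : ℝ) (m : ℕ) (f : ℝ → ℝ → ℝ) : Prop where
  cont : ∀ α β : ℕ, 2 * α + β ≤ m →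
    ContinuousOn (Function.uncurry (pd L α β f)) (Icc 0 L ×ˢ Ici 0)
  hasDerivX : ∀ α β : ℕ, 2 * (α + 1) + β ≤ m → ∀ x ∈ Icc 0 L, ∀ y ∈ Ici (0 : ℝ),
    HasDerivWithinAt (fun s => pd L α β f s y) (pd L (α + 1) β f x y) (Icc 0 L) x
  hasDerivY : ∀ α β : ℕ, 2 * α + (β + 1) ≤ m → ∀ x ∈ Icc 0 L, ∀ y ∈ Ici (0 : ℝ),
    HasDerivWithinAt (pd L α β f x) (pd L α (β + 1) f x y) (Ici 0) y

/-- `(u, v)` is a classical solution on `[0, L] × [0, ∞)`, with initial datum `u₀`, of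
`u ∂_x u + v ∂_y u - ∂_y² u + u - 1 = 0`, `∂_x u + ∂_y v = 0`,
`u = v = 0` at `y = 0`, `u → 1` as `y → ∞`. For `k ≥ 1` the regularity required of `v`
is implied by that of `u`, because `v` is minus the `y`-primitive of `∂_x u`. -/
structure IsSolution (k : ℕ) (L : ℝ) (u₀ : ℝ → ℝ) (u v : ℝ → ℝ → ℝ) : Prop where
  regular_u : ParabolicRegular L (2 * k) u
  regular_v : ParabolicRegular L (2 * k - 1) v
  momentum : ∀ x ∈ Icc 0 L, ∀ y ∈ Ici (0 : ℝ),
    u x y * pd L 1 0 u x y + v x y * pd L 0 1 u x y - pd L 0 2 u x y + u x y - 1 = 0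
  divergence_free : ∀ x ∈ Icc 0 L, ∀ y ∈ Ici (0 : ℝ), pd L 1 0 u x y + pd L 0 1 v x y = 0
  no_slip : ∀ x ∈ Icc 0 L, u x 0 = 0 ∧ v x 0 = 0
  far_field : ∀ x ∈ Icc 0 L, Tendsto (u x) atTop (𝓝 1)
  initial : ∀ y ∈ Ici (0 : ℝ), u 0 y = u₀ y

/-- The weight `⟨y⟩`. -/
def japanese (y : ℝ) : ℝ := √(1 + y ^ 2)

/-- The norm of `f ⟨y⟩^l` in `L^∞_x L^∞_y` over the strip `[0, L] × [0, ∞)`, for continuous `f`. -/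
def weightedSup (L l : ℝ) (f : ℝ → ℝ → ℝ) : ℝ≥0∞ :=
  ⨆ x ∈ Icc 0 L, ⨆ y ∈ Ici (0 : ℝ), ENNReal.ofReal (|f x y| * japanese y ^ l)

/-- The regularity estimate
`‖∂_x^α ∂_y^β u ⟨y⟩^l‖ + ‖∂_x^γ v ⟨y⟩^(l-1)‖ + ‖∂_x^α ∂_y^(β+1) b ⟨y⟩^l‖ ≤ C₀` in the norm of
`L^∞_x L^∞_y`, for `0 < 2 α + β ≤ 2 k` and `γ ≤ k - 1`, where `b` is the magnetic component, which
enters through `∂_y b = 1 - u` only. -/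
def RegularityEstimate (k : ℕ) (l L C₀ : ℝ) (u v : ℝ → ℝ → ℝ) : Prop :=
  ∀ α β γ : ℕ, 0 < 2 * α + β → 2 * α + β ≤ 2 * k → γ + 1 ≤ k →
    weightedSup L l (pd L α β u) + weightedSup L (l - 1) (pd L γ 0 v)
      + weightedSup L l (pd L α β (fun x y => 1 - u x y)) ≤ ENNReal.ofReal C₀

/-- The quotient `(v₂ - v₁) / u₂`. At `y = 0` it is `0`, which is its limit there when `u₂` and
`v₂ - v₁` vanish at `y = 0` to exactly first and at least second order. -/
def quotient (v₁ u₂ v₂ : ℝ → ℝ → ℝ) : ℝ → ℝ → ℝ :=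
  fun x y => (v₂ x y - v₁ x y) / u₂ x y

/-- The squared norm in `L²_y(0, ∞)`, with values in `[0, ∞]`. -/
def sqNorm (f : ℝ → ℝ) : ℝ≥0∞ :=
  eLpNorm f 2 (volume.restrict (Ioi 0)) ^ 2

end PrandtlHartmann

end

namespace PrandtlHartmann

/-! Uniqueness is proved directly, by comparison; the quotient then vanishes for `y ≥ 0`, and the
energy inequality reduces to `0 ≤ 0`. In von Mises variables `(x, p)`, where `p = ∫_0^y u` is the
stream function, the square `w = u²` satisfies the scalar equation `w_x = √w w_pp - 2√w + 2`, from
which `v` has disappeared. Where the difference `W` of two such squares is positive, `W_x ≤ u₁ W_pp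
+ 2K W`, provided the second solution satisfies `u_yy - u ≤ K u²` (`exists_uyy_sub_le`). This bound
survives the degeneracy at the wall because the equation forces `u_yy = -1` there; elsewhere `u` is
bounded below. Since `W` vanishes initially and at the wall and decays uniformly as `p → ∞`, the
maximum principle `nonpos_of_parabolic` gives `W ≤ 0`, and exchanging the solutions gives `W = 0`.
The change of variables needs `u > 0` off the wall (`IsProfile.pos`), again a consequence of `u_yy =
-1` at a degenerate zero. It is undone by noting that the height has `p`-derivative `1/u`, so equal
velocities in von Mises variables give equal heights. -/

/-! ### Maximum principles. -/

theorem deriv_two_nonpos_of_isLocalMax {f f' : ℝ → ℝ} {f'' a : ℝ} (h : IsLocalMax f a)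
    (hf : ∀ᶠ x in 𝓝 a, HasDerivAt f (f' x) x) (hf' : HasDerivAt f' f'' a) : f'' ≤ 0 := by
  by_contra! hpos
  have hd : deriv f =ᶠ[𝓝 a] f' := hf.mono fun x hx => hx.deriv
  have hdd : deriv (deriv f) a = f'' := by rw [hd.deriv_eq, hf'.deriv]
  -- A positive second derivative makes the maximum a local minimum too, so `f` is locally constant
  -- and its second derivative is zero.
  have hmin : IsLocalMin f a :=
    isLocalMin_of_deriv_deriv_pos (by rw [hdd]; exact hpos) h.deriv_eq_zero
      hf.self_of_nhds.continuousAt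
  have hc : f =ᶠ[𝓝 a] fun _ => f a := by
    filter_upwards [h, hmin] with x h1 h2
    exact le_antisymm h1 h2
  have : deriv (deriv f) a = 0 := by
    rw [hc.deriv.deriv_eq]; simp
  linarith

theorem deriv_two_nonneg_of_isLocalMin {f f' : ℝ → ℝ} {f'' a : ℝ} (h : IsLocalMin f a)
    (hf : ∀ᶠ x in 𝓝 a, HasDerivAt f (f' x) x) (hf' : HasDerivAt f' f'' a) : 0 ≤ f'' := by
  have := deriv_two_nonpos_of_isLocalMax (f := -f) (f' := -f') (f'' := -f'') h.neg
    (hf.mono fun x hx => hx.neg) hf'.neg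
  linarith

theorem deriv_nonneg_of_le_left {g : ℝ → ℝ} {g' x : ℝ} (hg : HasDerivAt g g' x)
    (h : ∀ᶠ s in 𝓝[<] x, g s ≤ g x) : 0 ≤ g' := by
  have ht := (hasDerivWithinAt_iff_tendsto_slope' (s := Iio x) (by simp)).1 hg.hasDerivWithinAt
  refine ge_of_tendsto ht ?_
  filter_upwards [h, self_mem_nhdsWithin] with s hs hsx
  rw [slope_def_field]
  exact div_nonneg_of_nonpos (by linarith) (by linarith [mem_Iio.1 hsx])

/-- A weak maximum principle on the half strip `[0, T] × [0, ∞)` for a degenerate parabolic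
inequality `∂_x W ≤ a ∂_p² W + K W` which is only required where `W > 0`. -/
theorem nonpos_of_parabolic {T K : ℝ} {W : ℝ → ℝ → ℝ}
    (hcont : ContinuousOn (Function.uncurry W) (Icc 0 T ×ˢ Ici 0))
    (h_init : ∀ p ∈ Ici (0 : ℝ), W 0 p ≤ 0) (h_bdry : ∀ x ∈ Icc 0 T, W x 0 ≤ 0)
    (h_far : ∀ ε > 0, ∃ P, ∀ x ∈ Icc 0 T, ∀ p ≥ P, W x p ≤ ε) (hK : 0 ≤ K)
    (hW : ∀ x ∈ Ioc 0 T, ∀ p > 0, 0 < W x p → ∃ (wx a wpp : ℝ) (wp : ℝ → ℝ),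
      HasDerivAt (fun s => W s p) wx x ∧ (∀ᶠ q in 𝓝 p, HasDerivAt (W x) (wp q) q) ∧
      HasDerivAt wp wpp p ∧ 0 ≤ a ∧ wx ≤ a * wpp + K * W x p) :
    ∀ x ∈ Icc 0 T, ∀ p ∈ Ici (0 : ℝ), W x p ≤ 0 := by
  intro x₁ hx₁ p₁ hp₁
  by_contra! hpos
  -- The rate `K + 1` exceeds `K`, so at a positive maximum of `E W` the inequality is violated
  -- strictly.
  set E : ℝ → ℝ := fun x => Real.exp (-(K + 1) * x) with hE
  have hE0 : ∀ x, 0 < E x := fun x => Real.exp_pos _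
  have hE1 : ∀ x ∈ Icc 0 T, E x ≤ 1 := fun x hx => by
    rw [hE]; exact Real.exp_le_one_iff.2 (by nlinarith [hx.1])
  set m := E x₁ * W x₁ p₁ with hm
  have hm0 : 0 < m := mul_pos (hE0 _) hpos
  -- Since `E ≤ 1`, `W` is at least `m > m / 2` at the maximiser, which therefore lies below `P`.
  obtain ⟨P, hP⟩ := h_far (m / 2) (by linarith)
  set R := max P p₁ + 1 with hR
  have hRp : p₁ < R := by rw [hR]; linarith [le_max_right P p₁]
  have hRP : P < R := by rw [hR]; linarith [le_max_left P p₁]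
  have hsub : Icc 0 T ×ˢ Icc 0 R ⊆ Icc 0 T ×ˢ Ici (0 : ℝ) :=
    prod_mono_right fun y hy => hy.1
  have hcomp : IsCompact (Icc 0 T ×ˢ Icc 0 R) := isCompact_Icc.prod isCompact_Icc
  have hc : ContinuousOn (fun z : ℝ × ℝ => E z.1 * W z.1 z.2) (Icc 0 T ×ˢ Icc 0 R) :=
    (by fun_prop : Continuous fun z : ℝ × ℝ => E z.1).continuousOn.mul (hcont.mono hsub)
  have hmem : (x₁, p₁) ∈ Icc 0 T ×ˢ Icc 0 R := ⟨hx₁, hp₁, hRp.le⟩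
  obtain ⟨⟨x, p⟩, ⟨hx, hp⟩, hmax⟩ := hcomp.exists_isMaxOn ⟨_, hmem⟩ hc
  have hmV : m ≤ E x * W x p := hmax hmem
  have hWpos : 0 < W x p := pos_of_mul_pos_right (hm0.trans_le hmV) (hE0 x).le
  simp only at hx hp
  have hmW : m ≤ W x p := hmV.trans (mul_le_of_le_one_left hWpos.le (hE1 x hx))
  have hx0 : 0 < x := by
    rcases hx.1.lt_or_eq with h | h
    · exact h
    · subst h; linarith [h_init p hp.1]
  have hp0 : 0 < p := by
    rcases hp.1.lt_or_eq with h | h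
    · exact h
    · subst h; linarith [h_bdry x hx]
  have hpP : p < P := by
    by_contra! h
    linarith [hP x hx p h]
  have hpR : p < R := hpP.trans hRP
  obtain ⟨wx, a, wpp, wp, h1, h2, h3, ha, hle⟩ := hW x ⟨hx0, hx.2⟩ p hp0 hWpos
  have hloc : IsLocalMax (W x) p := by
    filter_upwards [Icc_mem_nhds hp0 hpR] with q hq
    exact le_of_mul_le_mul_left (hmax (show (x, q) ∈ Icc 0 T ×ˢ Icc 0 R from ⟨hx, hq⟩)) (hE0 x)
  have hwpp := deriv_two_nonpos_of_isLocalMax hloc h2 h3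
  have hEd : HasDerivAt E (E x * -(K + 1)) x := by
    simpa only [mul_one, id] using ((hasDerivAt_id x).const_mul (-(K + 1))).exp
  -- Only earlier `x` are compared, since the maximum may be attained at `x = T`.
  have hleft := deriv_nonneg_of_le_left (hEd.mul h1) (by
    filter_upwards [Ioo_mem_nhdsLT hx0] with s hs
    exact hmax (show (s, p) ∈ Icc 0 T ×ˢ Icc 0 R from ⟨⟨hs.1.le, hs.2.le.trans hx.2⟩, hp⟩))
  have hfin : 0 ≤ E x * (wx - (K + 1) * W x p) := by
    have : E x * (wx - (K + 1) * W x p) = E x * -(K + 1) * W x p + E x * wx := by ring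
    rw [this]; exact hleft
  have := nonneg_of_mul_nonneg_right hfin (hE0 x)
  nlinarith [mul_nonneg ha (neg_nonneg.2 hwpp)]

/-! ### Profiles: positivity and uniform bounds. -/

/-- The data of a classical solution which the uniqueness argument uses: the velocity `(u, v)`
with its derivatives `ux = ∂_x u`, `uy = ∂_y u`, `uyy = ∂_y² u`, where `ux` and `uyy` are
bounded by `M`. -/
structure IsProfile (L M : ℝ) (u v ux uy uyy : ℝ → ℝ → ℝ) : Prop where
  cont_u : ContinuousOn (Function.uncurry u) (Icc 0 L ×ˢ Ici 0)
  cont_v : ContinuousOn (Function.uncurry v) (Icc 0 L ×ˢ Ici 0)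
  cont_ux : ContinuousOn (Function.uncurry ux) (Icc 0 L ×ˢ Ici 0)
  cont_uy : ContinuousOn (Function.uncurry uy) (Icc 0 L ×ˢ Ici 0)
  cont_uyy : ContinuousOn (Function.uncurry uyy) (Icc 0 L ×ˢ Ici 0)
  deriv_x : ∀ x ∈ Icc 0 L, ∀ y ∈ Ici (0 : ℝ),
    HasDerivWithinAt (fun s => u s y) (ux x y) (Icc 0 L) x
  deriv_y : ∀ x ∈ Icc 0 L, ∀ y ∈ Ici (0 : ℝ), HasDerivWithinAt (u x) (uy x y) (Ici 0) y
  deriv_yy : ∀ x ∈ Icc 0 L, ∀ y ∈ Ici (0 : ℝ), HasDerivWithinAt (uy x) (uyy x y) (Ici 0) y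
  deriv_v : ∀ x ∈ Icc 0 L, ∀ y ∈ Ici (0 : ℝ), HasDerivWithinAt (v x) (-ux x y) (Ici 0) y
  momentum : ∀ x ∈ Icc 0 L, ∀ y ∈ Ici (0 : ℝ),
    u x y * ux x y + v x y * uy x y - uyy x y + u x y - 1 = 0
  u_zero : ∀ x ∈ Icc 0 L, u x 0 = 0
  v_zero : ∀ x ∈ Icc 0 L, v x 0 = 0
  far_field : ∀ x ∈ Icc 0 L, Tendsto (u x) atTop (𝓝 1)
  nonneg_bound : 0 ≤ M
  abs_ux_le : ∀ x ∈ Icc 0 L, ∀ y ∈ Ici (0 : ℝ), |ux x y| ≤ M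
  abs_uyy_le : ∀ x ∈ Icc 0 L, ∀ y ∈ Ici (0 : ℝ), |uyy x y| ≤ M

namespace IsProfile

variable {L M : ℝ} {u v ux uy uyy : ℝ → ℝ → ℝ}

theorem hasDerivAt_y (h : IsProfile L M u v ux uy uyy) {x y : ℝ} (hx : x ∈ Icc 0 L)
    (hy : 0 < y) : HasDerivAt (u x) (uy x y) y :=
  (h.deriv_y x hx y hy.le).hasDerivAt (Ici_mem_nhds hy)

theorem hasDerivAt_yy (h : IsProfile L M u v ux uy uyy) {x y : ℝ} (hx : x ∈ Icc 0 L)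
    (hy : 0 < y) : HasDerivAt (uy x) (uyy x y) y :=
  (h.deriv_yy x hx y hy.le).hasDerivAt (Ici_mem_nhds hy)

theorem hasDerivAt_x (h : IsProfile L M u v ux uy uyy) {x y : ℝ} (hx : x ∈ Ioo 0 L)
    (hy : 0 ≤ y) : HasDerivAt (fun s => u s y) (ux x y) x :=
  (h.deriv_x x (Ioo_subset_Icc_self hx) y hy).hasDerivAt (Icc_mem_nhds hx.1 hx.2)

theorem continuousOn_y (h : IsProfile L M u v ux uy uyy) {x : ℝ} (hx : x ∈ Icc 0 L) :
    ContinuousOn (u x) (Ici 0) :=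
  fun y hy => (h.deriv_y x hx y hy).continuousWithinAt

/-- The Lipschitz constant in `x` does not depend on `y`; this carries far-field information from
one `x` to its neighbours. -/
theorem abs_sub_le (h : IsProfile L M u v ux uy uyy) {x x' y : ℝ} (hx : x ∈ Icc 0 L)
    (hx' : x' ∈ Icc 0 L) (hy : 0 ≤ y) : |u x' y - u x y| ≤ M * |x' - x| := by
  simpa only [Real.norm_eq_abs] using
    (convex_Icc 0 L).norm_image_sub_le_of_norm_hasDerivWithin_le (f := fun s => u s y)
      (fun s hs => h.deriv_x s hs y hy) (fun s hs => h.abs_ux_le s hs y hy) hx hx'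

/-- The equation at the wall: the imposed pressure is favourable. -/
theorem uyy_zero (h : IsProfile L M u v ux uy uyy) {x : ℝ} (hx : x ∈ Icc 0 L) :
    uyy x 0 = -1 := by
  have := h.momentum x hx 0 self_mem_Ici
  rw [h.u_zero x hx, h.v_zero x hx] at this
  linarith

/-- At an interior zero, a minimum, `u = u_y = 0` and `u_yy ≥ 0`, whereas the equation reduces to
`u_yy = -1`. -/
theorem pos_of_nonneg (h : IsProfile L M u v ux uy uyy) {x y : ℝ} (hx : x ∈ Icc 0 L)
    (hu : ∀ y ∈ Ici (0 : ℝ), 0 ≤ u x y) (hy : 0 < y) : 0 < u x y := by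
  refine lt_of_le_of_ne (hu y hy.le) fun h0 => ?_
  have hmin : IsLocalMin (u x) y := by
    filter_upwards [Ici_mem_nhds hy] with z hz
    rw [← h0]; exact hu z hz
  have h1 : uy x y = 0 := hmin.hasDerivAt_eq_zero (h.hasDerivAt_y hx hy)
  have h2 : 0 ≤ uyy x y := deriv_two_nonneg_of_isLocalMin hmin
    ((eventually_gt_nhds hy).mono fun z hz => h.hasDerivAt_y hx hz) (h.hasDerivAt_yy hx hy)
  have := h.momentum x hx y hy.le
  rw [← h0, h1] at this
  linarith

/-- Because `u_yy = -1` at the wall, `u_y ≤ 0` there would make `u_y` negative just above it, and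
`u` would decrease below zero. -/
theorem uy_zero_pos_of_nonneg (h : IsProfile L M u v ux uy uyy) {x : ℝ} (hx : x ∈ Icc 0 L)
    (hu : ∀ y ∈ Ici (0 : ℝ), 0 ≤ u x y) : 0 < uy x 0 := by
  by_contra! hle
  have hd := h.deriv_yy x hx 0 self_mem_Ici
  rw [h.uyy_zero hx, ← hasDerivWithinAt_Ioi_iff_Ici,
    hasDerivWithinAt_iff_tendsto_slope' (by simp)] at hd
  have hev : ∀ᶠ y in 𝓝[>] (0 : ℝ), uy x y < 0 := by
    filter_upwards [hd.eventually_lt_const (show (-1 : ℝ) < 0 by norm_num),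
      self_mem_nhdsWithin] with y hy hy0
    rw [slope_def_field, sub_zero, div_neg_iff] at hy
    rcases hy with hy | hy
    · linarith [mem_Ioi.1 hy0]
    · linarith
  obtain ⟨d, hd0, hd⟩ := mem_nhdsGT_iff_exists_Ioc_subset.1 hev
  have hd0' : (0 : ℝ) < d := hd0
  have hanti : StrictAntiOn (u x) (Icc 0 d) := by
    refine strictAntiOn_of_deriv_neg (convex_Icc 0 d)
      ((h.continuousOn_y hx).mono fun y hy => hy.1) fun y hy => ?_
    rw [interior_Icc] at hy
    rw [(h.hasDerivAt_y hx hy.1).deriv]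
    exact hd ⟨hy.1, hy.2.le⟩
  have := hanti (left_mem_Icc.2 hd0'.le) (right_mem_Icc.2 hd0'.le) hd0'
  rw [h.u_zero x hx] at this
  linarith [hu d hd0'.le]

/-- Positivity of the tangential velocity is an open condition in `x`. -/
theorem eventually_nonneg (h : IsProfile L M u v ux uy uyy) {x : ℝ} (hx : x ∈ Icc 0 L)
    (hu : ∀ y ∈ Ici (0 : ℝ), 0 ≤ u x y) :
    ∀ᶠ s in 𝓝 x, s ∈ Icc 0 L → ∀ y ∈ Ici (0 : ℝ), 0 ≤ u s y := by
  -- Three zones: near the wall `u_y > 0` persists by continuity, in the middle `u > 0` persists by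
  -- compactness, and far out `u ≥ 1/2` changes by less than `1/2`.
  have hwall : ∀ᶠ z in 𝓝 x ×ˢ 𝓝 (0 : ℝ), z ∈ Icc 0 L ×ˢ Ici (0 : ℝ) → 0 < uy z.1 z.2 := by
    rw [← nhds_prod_eq, ← eventually_nhdsWithin_iff]
    exact (h.cont_uy (x, 0) ⟨hx, self_mem_Ici⟩).eventually_const_lt
      (h.uy_zero_pos_of_nonneg hx hu)
  obtain ⟨p, hp, q, hq, hpq⟩ := Filter.eventually_prod_iff.1 hwall
  obtain ⟨d, hd0, hd⟩ := Metric.eventually_nhds_iff.1 hq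
  obtain ⟨R, hR⟩ := eventually_atTop.1
    ((h.far_field x hx).eventually_const_le (show (1 / 2 : ℝ) < 1 by norm_num))
  have hmid : ∀ᶠ s in 𝓝 x, ∀ y ∈ Icc (d / 2) R, s ∈ Icc 0 L → 0 < u s y := by
    refine isCompact_Icc.eventually_forall_of_forall_eventually fun y hy => ?_
    have hy0 : 0 < y := by linarith [hy.1]
    have := (h.cont_u (x, y) ⟨hx, hy0.le⟩).eventually_const_lt (h.pos_of_nonneg hx hu hy0)
    rw [eventually_nhdsWithin_iff] at this
    have h2 : ∀ᶠ z : ℝ × ℝ in 𝓝 (x, y), 0 < z.2 :=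
      continuous_snd.continuousAt.eventually_const_lt hy0
    filter_upwards [this, h2] with z hz hz2 hz1
    exact hz ⟨hz1, hz2.le⟩
  have hnear : ∀ᶠ s in 𝓝 x, M * |s - x| < 1 / 2 := by
    have : ContinuousAt (fun s => M * |s - x|) x := by fun_prop
    exact this.eventually_lt_const (by simp)
  filter_upwards [hp, hmid, hnear] with s hps hmid hnear hs y hy
  rcases le_or_gt R y with hRy | hRy
  · have := (abs_le.1 (h.abs_sub_le hx hs hy)).1
    linarith [hR y hRy]
  rcases le_or_gt (d / 2) y with hdy | hdy
  · exact (hmid y ⟨hdy, hRy.le⟩ hs).le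
  have hmono : MonotoneOn (u s) (Icc 0 (d / 2)) := by
    refine monotoneOn_of_deriv_nonneg (convex_Icc _ _)
      ((h.continuousOn_y hs).mono fun y hy => hy.1) ?_ ?_
    · intro z hz
      rw [interior_Icc] at hz
      exact (h.hasDerivAt_y hs hz.1).differentiableAt.differentiableWithinAt
    · intro z hz
      rw [interior_Icc] at hz
      rw [(h.hasDerivAt_y hs hz.1).deriv]
      refine (hpq hps (hd (y := z) ?_) ⟨hs, hz.1.le⟩).le
      rw [Real.dist_eq, sub_zero, abs_of_pos hz.1]
      linarith [hz.2]
  have := hmono (left_mem_Icc.2 (by linarith)) ⟨hy, hdy.le⟩ hy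
  rwa [h.u_zero s hs] at this

/-- No separation: a profile which is initially positive stays positive. -/
theorem pos (h : IsProfile L M u v ux uy uyy) (h0 : ∀ y > 0, 0 < u 0 y) {x y : ℝ}
    (hx : x ∈ Icc 0 L) (hy : 0 < y) : 0 < u x y := by
  have hL : (0 : ℝ) ≤ L := hx.1.trans hx.2
  set S : Set ℝ := {x | ∀ y ∈ Ici (0 : ℝ), 0 ≤ u x y} with hS
  have hclosed : IsClosed (S ∩ Icc 0 L) := by
    have : S ∩ Icc 0 L = ⋂ y ∈ Ici (0 : ℝ), {x ∈ Icc 0 L | 0 ≤ u x y} := by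
      ext x
      simp only [hS, mem_inter_iff, mem_ofPred_eq, mem_iInter]
      exact ⟨fun h y hy => ⟨h.2, h.1 y hy⟩, fun h => ⟨fun y hy => (h y hy).2, (h 0 self_mem_Ici).1⟩⟩
    rw [this]
    refine isClosed_biInter fun y hy => ?_
    have hcont : ContinuousOn (fun x => u x y) (Icc 0 L) :=
      fun x hx => (h.deriv_x x hx y hy).continuousWithinAt
    exact hcont.preimage_isClosed_of_isClosed isClosed_Icc isClosed_Ici
  -- Continuous induction in `x`: the set is closed, contains `0`, and extends to the right of each
  -- of its points.
  have hsub : Icc 0 L ⊆ S := by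
    refine hclosed.Icc_subset_of_forall_mem_nhdsWithin ?_ ?_
    · intro y hy
      rcases (mem_Ici.1 hy).lt_or_eq with h' | h'
      · exact (h0 y h').le
      · rw [← h', h.u_zero 0 ⟨le_rfl, hL⟩]
    · rintro x ⟨hxS, hx⟩
      filter_upwards [nhdsWithin_le_nhds (h.eventually_nonneg (Ico_subset_Icc_self hx) hxS),
        Ioo_mem_nhdsGT hx.2] with s hs hsx
      exact hs ⟨hx.1.trans hsx.1.le, hsx.2.le⟩
  exact h.pos_of_nonneg hx (hsub hx) hy

theorem uniform_far_field (h : IsProfile L M u v ux uy uyy) {ε : ℝ} (hε : 0 < ε) :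
    ∃ R ≥ 0, ∀ x ∈ Icc 0 L, ∀ y ≥ R, |u x y - 1| ≤ ε := by
  -- Compact induction runs over arbitrary sets `s`, so membership in the interval is kept as a
  -- separate condition.
  suffices H : ∃ R ≥ 0, ∀ x ∈ Icc 0 L, x ∈ Icc 0 L → ∀ y ≥ R, |u x y - 1| ≤ ε by
    obtain ⟨R, hR0, hR⟩ := H
    exact ⟨R, hR0, fun x hx => hR x hx hx⟩
  refine isCompact_Icc.induction_on
    (p := fun s => ∃ R ≥ 0, ∀ x ∈ s, x ∈ Icc 0 L → ∀ y ≥ R, |u x y - 1| ≤ ε) ?_ ?_ ?_ ?_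
  · exact ⟨0, le_rfl, by simp⟩
  · rintro s t hst ⟨R, hR0, hR⟩
    exact ⟨R, hR0, fun x hx => hR x (hst hx)⟩
  · rintro s t ⟨R, hR0, hR⟩ ⟨R', hR'0, hR'⟩
    refine ⟨max R R', hR0.trans (le_max_left _ _), fun x hx hxL y hy => ?_⟩
    rcases hx with hx | hx
    · exact hR x hx hxL y ((le_max_left _ _).trans hy)
    · exact hR' x hx hxL y ((le_max_right _ _).trans hy)
  · intro x hx
    obtain ⟨R, hR⟩ := Metric.tendsto_atTop.1 (h.far_field x hx) (ε / 2) (by linarith)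
    have hnear : ∀ᶠ s in 𝓝 x, M * |s - x| < ε / 2 := by
      have : ContinuousAt (fun s => M * |s - x|) x := by fun_prop
      exact this.eventually_lt_const (by simp; linarith)
    refine ⟨_, nhdsWithin_le_nhds hnear, max R 0, le_max_right _ _, fun s hs hsL y hy => ?_⟩
    have h1 := h.abs_sub_le hx hsL ((le_max_right R 0).trans hy)
    have h2 := hR y ((le_max_left R 0).trans hy)
    rw [Real.dist_eq] at h2
    have h3 : M * |s - x| < ε / 2 := hs
    calc |u s y - 1| ≤ |u s y - u x y| + |u x y - 1| := _root_.abs_sub_le _ _ _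
      _ ≤ ε := by linarith

/-- The zeroth order coefficient of the linearised von Mises equation is bounded above. -/
theorem exists_uyy_sub_le (h : IsProfile L M u v ux uy uyy) (h0 : ∀ y > 0, 0 < u 0 y) :
    ∃ K ≥ 0, ∀ x ∈ Icc 0 L, ∀ y ∈ Ici (0 : ℝ), uyy x y - u x y ≤ K * u x y ^ 2 := by
  have hnn : ∀ x ∈ Icc 0 L, ∀ y ∈ Ici (0 : ℝ), 0 ≤ u x y := fun x hx y hy => by
    rcases (mem_Ici.1 hy).lt_or_eq with h' | h'
    · exact (h.pos h0 hx h').le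
    · rw [← h', h.u_zero x hx]
  obtain ⟨R, hR0, hR⟩ := h.uniform_far_field (show (0 : ℝ) < 1 / 2 by norm_num)
  -- Where `u ≥ c > 0`, the bound `u_yy ≤ M` suffices, as `M ≤ (M / c²) u²`.
  have key : ∀ {c x y : ℝ}, 0 < c → x ∈ Icc 0 L → y ∈ Ici (0 : ℝ) → c ≤ u x y →
      uyy x y - u x y ≤ M / c ^ 2 * u x y ^ 2 := by
    intro c x y hc hx hy hcu
    have h1 := (abs_le.1 (h.abs_uyy_le x hx y hy)).2
    have h2 : M / c ^ 2 * c ^ 2 ≤ M / c ^ 2 * u x y ^ 2 :=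
      mul_le_mul_of_nonneg_left (pow_le_pow_left₀ hc.le hcu 2)
        (div_nonneg h.nonneg_bound (sq_nonneg c))
    rw [div_mul_cancel₀ _ (pow_ne_zero 2 hc.ne')] at h2
    linarith [hnn x hx y hy]
  have hcompact : ∃ K ≥ 0, ∀ z ∈ Icc 0 L ×ˢ Icc 0 R, z ∈ Icc 0 L ×ˢ Icc 0 R →
      uyy z.1 z.2 - u z.1 z.2 ≤ K * u z.1 z.2 ^ 2 := by
    refine (isCompact_Icc.prod isCompact_Icc).induction_on
      (p := fun s => ∃ K ≥ 0, ∀ z ∈ s, z ∈ Icc 0 L ×ˢ Icc 0 R →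
        uyy z.1 z.2 - u z.1 z.2 ≤ K * u z.1 z.2 ^ 2) ?_ ?_ ?_ ?_
    · exact ⟨0, le_rfl, by simp⟩
    · rintro s t hst ⟨K, hK0, hK⟩
      exact ⟨K, hK0, fun x hx => hK x (hst hx)⟩
    · rintro s t ⟨K, hK0, hK⟩ ⟨K', hK'0, hK'⟩
      refine ⟨K + K', add_nonneg hK0 hK'0, fun z hz hzL => ?_⟩
      rcases hz with hz | hz
      · nlinarith [hK z hz hzL, mul_nonneg hK'0 (sq_nonneg (u z.1 z.2))]
      · nlinarith [hK' z hz hzL, mul_nonneg hK0 (sq_nonneg (u z.1 z.2))]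
    · rintro ⟨x, y⟩ ⟨hx, hy⟩
      simp only at hx hy
      have hsub : Icc 0 L ×ˢ Icc 0 R ⊆ Icc 0 L ×ˢ Ici (0 : ℝ) := prod_mono_right fun y hy => hy.1
      rcases hy.1.lt_or_eq with hy0 | hy0
      · have hu := h.pos h0 hx hy0
        have hev := ((h.cont_u.mono hsub) (x, y) ⟨hx, hy⟩).eventually_const_lt
          (show u x y / 2 < Function.uncurry u (x, y) from half_lt_self hu)
        refine ⟨_, hev, M / (u x y / 2) ^ 2, div_nonneg h.nonneg_bound (sq_nonneg _), ?_⟩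
        rintro z hz ⟨hz1, hz2⟩
        exact key (half_pos hu) hz1 hz2.1 (le_of_lt hz)
      -- Near the wall `u_yy < 0`, so `K = 0` works even though `u` degenerates.
      · subst hy0
        have hev := ((h.cont_uyy.mono hsub) (x, 0) ⟨hx, hy⟩).eventually_lt_const
          (show Function.uncurry uyy (x, 0) < 0 by
            simp only [Function.uncurry, h.uyy_zero hx]; norm_num)
        refine ⟨_, hev, 0, le_rfl, ?_⟩
        rintro z hz ⟨hz1, hz2⟩
        have hz' : uyy z.1 z.2 < 0 := hz
        linarith [hnn z.1 hz1 z.2 hz2.1]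
  obtain ⟨K, hK0, hK⟩ := hcompact
  have hM : 0 ≤ M / (1 / 2 : ℝ) ^ 2 := div_nonneg h.nonneg_bound (sq_nonneg _)
  refine ⟨K + M / (1 / 2) ^ 2, add_nonneg hK0 hM, fun x hx y hy => ?_⟩
  rcases le_or_gt R y with hRy | hRy
  · have h1 := (abs_le.1 (hR x hx y hRy)).1
    have := key (c := 1 / 2) (by norm_num) hx hy (by linarith)
    nlinarith [mul_nonneg hK0 (sq_nonneg (u x y))]
  · have := hK (x, y) ⟨hx, hy, hRy.le⟩ ⟨hx, hy, hRy.le⟩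
    simp only at this
    nlinarith [mul_nonneg hM (sq_nonneg (u x y))]

end IsProfile

/-! ### Chain rule and implicit differentiation. -/

/-- The chain rule for `s ↦ f s (g s)` in terms of continuous partial derivatives. -/
theorem hasDerivAt_comp_of_partials {f f₁ f₂ : ℝ → ℝ → ℝ} {g : ℝ → ℝ} {g' x : ℝ}
    (df₁ : ∀ᶠ z : ℝ × ℝ in 𝓝 (x, g x), HasDerivAt (fun s => f s z.2) (f₁ z.1 z.2) z.1)
    (df₂ : ∀ᶠ z : ℝ × ℝ in 𝓝 (x, g x), HasDerivAt (f z.1) (f₂ z.1 z.2) z.2)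
    (cf₁ : ContinuousAt (Function.uncurry f₁) (x, g x))
    (cf₂ : ContinuousAt (Function.uncurry f₂) (x, g x)) (hg : HasDerivAt g g' x) :
    HasDerivAt (fun s => f s (g s)) (f₁ x (g x) + f₂ x (g x) * g') x := by
  have hF := (hasStrictFDerivAt_uncurry_coprod (𝕜 := ℝ) (u := (x, g x)) (f := f)
    (f₁ := fun a b => ContinuousLinearMap.toSpanSingleton ℝ (f₁ a b))
    (f₂ := fun a b => ContinuousLinearMap.toSpanSingleton ℝ (f₂ a b))
    (df₁.mono fun z hz => hz.hasFDerivAt) (df₂.mono fun z hz => hz.hasFDerivAt)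
    ((ContinuousLinearMap.toSpanSingletonCLE (𝕜 := ℝ) (E := ℝ)).continuous.continuousAt.comp cf₁)
    ((ContinuousLinearMap.toSpanSingletonCLE (𝕜 := ℝ) (E := ℝ)).continuous.continuousAt.comp
      cf₂)).hasFDerivAt
  have := hF.comp_hasDerivAt x ((hasDerivAt_id x).prodMk hg)
  convert! this using 1
  simp [Function.HasUncurry.uncurry, mul_comm]

/-- A continuous solution `g` of `f s (g s) = c` is differentiable. -/
theorem differentiableAt_of_partials {f f₁ f₂ : ℝ → ℝ → ℝ} {g : ℝ → ℝ} {c x : ℝ}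
    (df₁ : ∀ᶠ z : ℝ × ℝ in 𝓝 (x, g x), HasDerivAt (fun s => f s z.2) (f₁ z.1 z.2) z.1)
    (df₂ : ∀ᶠ z : ℝ × ℝ in 𝓝 (x, g x), HasDerivAt (f z.1) (f₂ z.1 z.2) z.2)
    (cf₁ : ContinuousAt (Function.uncurry f₁) (x, g x))
    (cf₂ : ContinuousAt (Function.uncurry f₂) (x, g x)) (hne : f₂ x (g x) ≠ 0)
    (hg : ContinuousAt g x) (hfg : ∀ᶠ s in 𝓝 x, f s (g s) = c) : DifferentiableAt ℝ g x := by
  have d₁ : ∀ᶠ z : ℝ × ℝ in 𝓝 (x, g x), HasFDerivAt (f · z.2)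
      ((fun a b => ContinuousLinearMap.toSpanSingleton ℝ (f₁ a b)) z.1 z.2) z.1 :=
    df₁.mono fun z hz => hz.hasFDerivAt
  have d₂ : ∀ᶠ z : ℝ × ℝ in 𝓝 (x, g x), HasFDerivAt (f z.1 ·)
      ((fun a b => ContinuousLinearMap.toSpanSingleton ℝ (f₂ a b)) z.1 z.2) z.2 :=
    df₂.mono fun z hz => hz.hasFDerivAt
  have c₁ : ContinuousAt ↿(fun a b => ContinuousLinearMap.toSpanSingleton ℝ (f₁ a b)) (x, g x) :=
    (ContinuousLinearMap.toSpanSingletonCLE (𝕜 := ℝ) (E := ℝ)).continuous.continuousAt.comp cf₁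
  have c₂ : ContinuousAt ↿(fun a b => ContinuousLinearMap.toSpanSingleton ℝ (f₂ a b)) (x, g x) :=
    (ContinuousLinearMap.toSpanSingletonCLE (𝕜 := ℝ) (E := ℝ)).continuous.continuousAt.comp cf₂
  have hinv : (ContinuousLinearMap.toSpanSingleton ℝ (f₂ x (g x))).IsInvertible :=
    ⟨ContinuousLinearEquiv.unitsEquivAut ℝ (Units.mk0 _ hne), by ext; simp⟩
  -- By local uniqueness the continuous `g` agrees with the implicit function near `x`, and inherits
  -- its differentiability.
  have hev := eventually_apply_eq_iff_implicitFunctionOfBivariate d₁ d₂ c₁ c₂ hinv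
  have hdiff := (hasStrictFDerivAt_implicitFunctionOfBivariate d₁ d₂ c₁ c₂ hinv).differentiableAt
  refine hdiff.congr_of_eventuallyEq ?_
  have hpair : Tendsto (fun s => (s, g s)) (𝓝 x) (𝓝 (x, g x)) := continuousAt_id.prodMk hg
  filter_upwards [hpair.eventually hev, hfg] with s hs hsc
  exact (hs.1 (hsc.trans hfg.self_of_nhds.symm)).symm

/-! ### Von Mises variables. -/

/-- The stream function `∫_0^y u`. -/
noncomputable def stream (u : ℝ → ℝ → ℝ) (x y : ℝ) : ℝ := ∫ s in (0 : ℝ)..y, u x s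

/-- The height at which the stream function takes the value `p`. -/
noncomputable def level (u : ℝ → ℝ → ℝ) (x p : ℝ) : ℝ := Function.invFunOn (stream u x) (Ici 0) p

@[simp]
theorem stream_zero (u : ℝ → ℝ → ℝ) (x : ℝ) : stream u x 0 = 0 := by simp [stream]

namespace IsProfile

variable {L M : ℝ} {u v ux uy uyy : ℝ → ℝ → ℝ}

theorem intervalIntegrable (h : IsProfile L M u v ux uy uyy) {x a b : ℝ} (hx : x ∈ Icc 0 L)
    (ha : 0 ≤ a) (hb : 0 ≤ b) : IntervalIntegrable (u x) volume a b :=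
  ((h.continuousOn_y hx).mono fun _ hy => (le_min ha hb).trans hy.1).intervalIntegrable

theorem hasDerivWithinAt_stream (h : IsProfile L M u v ux uy uyy) {x y : ℝ} (hx : x ∈ Icc 0 L)
    (hy : 0 ≤ y) : HasDerivWithinAt (stream u x) (u x y) (Ici 0) y := by
  have hmeas : StronglyMeasurableAtFilter (u x) (𝓝[>] (0 : ℝ)) :=
    ⟨Ioi 0, self_mem_nhdsWithin, ((h.continuousOn_y hx).mono
      Ioi_subset_Ici_self).aestronglyMeasurable measurableSet_Ioi⟩
  rcases hy.lt_or_eq with hy0 | hy0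
  · refine (intervalIntegral.integral_hasDerivAt_right (h.intervalIntegrable hx le_rfl hy)
      ?_ ((h.continuousOn_y hx).continuousAt (Ici_mem_nhds hy0))).hasDerivWithinAt
    exact ((h.continuousOn_y hx).mono Ioi_subset_Ici_self).stronglyMeasurableAtFilter isOpen_Ioi y
      hy0
  · subst hy0
    exact intervalIntegral.integral_hasDerivWithinAt_right (by simp) hmeas
      ((h.continuousOn_y hx 0 self_mem_Ici).mono Ioi_subset_Ici_self)

theorem hasDerivAt_stream (h : IsProfile L M u v ux uy uyy) {x y : ℝ} (hx : x ∈ Icc 0 L)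
    (hy : 0 < y) : HasDerivAt (stream u x) (u x y) y :=
  (h.hasDerivWithinAt_stream hx hy.le).hasDerivAt (Ici_mem_nhds hy)

theorem continuousOn_stream (h : IsProfile L M u v ux uy uyy) {x : ℝ} (hx : x ∈ Icc 0 L) :
    ContinuousOn (stream u x) (Ici 0) :=
  fun _ hy => (h.hasDerivWithinAt_stream hx hy).continuousWithinAt

theorem abs_stream_sub_le (h : IsProfile L M u v ux uy uyy) {x x' y : ℝ} (hx : x ∈ Icc 0 L)
    (hx' : x' ∈ Icc 0 L) (hy : 0 ≤ y) : |stream u x' y - stream u x y| ≤ M * |x' - x| * y := by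
  rw [stream, stream, ← intervalIntegral.integral_sub (h.intervalIntegrable hx' le_rfl hy)
    (h.intervalIntegrable hx le_rfl hy)]
  have := intervalIntegral.norm_integral_le_of_norm_le_const (a := 0) (b := y)
    (f := fun s => u x' s - u x s) (C := M * |x' - x|) fun s hs => by
      rw [uIoc_of_le hy] at hs
      exact h.abs_sub_le hx hx' hs.1.le
  rwa [sub_zero, abs_of_nonneg hy] at this

theorem continuousOn_uncurry_stream (h : IsProfile L M u v ux uy uyy) :
    ContinuousOn (Function.uncurry (stream u)) (Icc 0 L ×ˢ Ici 0) := by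
  rintro ⟨x, y⟩ ⟨hx, hy⟩
  simp only at hx hy
  have h1 : Tendsto (fun z : ℝ × ℝ => stream u x z.2) (𝓝[Icc 0 L ×ˢ Ici 0] (x, y))
      (𝓝 (stream u x y)) :=
    (h.continuousOn_stream hx y hy).tendsto.comp
      (continuousWithinAt_snd.tendsto_nhdsWithin fun z hz => hz.2)
  have h2 : Tendsto (fun z : ℝ × ℝ => stream u z.1 z.2 - stream u x z.2)
      (𝓝[Icc 0 L ×ˢ Ici 0] (x, y)) (𝓝 0) := by
    have hb : Tendsto (fun z : ℝ × ℝ => M * |z.1 - x| * z.2) (𝓝[Icc 0 L ×ˢ Ici 0] (x, y))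
        (𝓝 0) := by
      have : Continuous fun z : ℝ × ℝ => M * |z.1 - x| * z.2 := by fun_prop
      simpa using (this.tendsto (x, y)).mono_left nhdsWithin_le_nhds
    refine squeeze_zero_norm' ?_ hb
    filter_upwards [self_mem_nhdsWithin] with z hz
    exact h.abs_stream_sub_le hx hz.1 hz.2
  have := h1.add h2
  rw [add_zero] at this
  exact this.congr fun z => by simp [Function.uncurry]

theorem strictMonoOn_stream (h : IsProfile L M u v ux uy uyy) (h0 : ∀ y > 0, 0 < u 0 y) {x : ℝ}
    (hx : x ∈ Icc 0 L) : StrictMonoOn (stream u x) (Ici 0) := by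
  refine strictMonoOn_of_deriv_pos (convex_Ici 0) (h.continuousOn_stream hx) fun y hy => ?_
  rw [interior_Ici] at hy
  rw [(h.hasDerivAt_stream hx hy).deriv]
  exact h.pos h0 hx hy

theorem stream_nonneg (h : IsProfile L M u v ux uy uyy) (h0 : ∀ y > 0, 0 < u 0 y) {x y : ℝ}
    (hx : x ∈ Icc 0 L) (hy : 0 ≤ y) : 0 ≤ stream u x y := by
  simpa using (h.strictMonoOn_stream h0 hx).monotoneOn self_mem_Ici hy hy

theorem exists_stream_eq (h : IsProfile L M u v ux uy uyy) (h0 : ∀ y > 0, 0 < u 0 y) {x p : ℝ}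
    (hx : x ∈ Icc 0 L) (hp : 0 ≤ p) : ∃ y ∈ Ici (0 : ℝ), stream u x y = p := by
  obtain ⟨R, hR⟩ := eventually_atTop.1
    ((h.far_field x hx).eventually_const_le (show (1 / 2 : ℝ) < 1 by norm_num))
  set a := max R 0 with ha
  have ha0 : 0 ≤ a := le_max_right _ _
  have hmono : MonotoneOn (fun y => stream u x y - 1 / 2 * y) (Ici a) := by
    refine monotoneOn_of_deriv_nonneg (convex_Ici a)
      (((h.continuousOn_stream hx).mono (Ici_subset_Ici.2 ha0)).sub (by fun_prop)) ?_ ?_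
    all_goals
      intro y hy
      rw [interior_Ici] at hy
      have hd := (h.hasDerivAt_stream hx (ha0.trans_lt hy)).sub
        ((hasDerivAt_id y).const_mul (1 / 2 : ℝ))
    · exact hd.differentiableAt.differentiableWithinAt
    · have : deriv (fun y => stream u x y - 1 / 2 * y) y = u x y - 1 / 2 * 1 := hd.deriv
      rw [this]
      linarith [hR y ((le_max_left R 0).trans (le_of_lt hy))]
  -- Beyond `a` the stream function grows with slope at least `1/2`, so a further distance `2 * p`
  -- adds at least `p`.
  have hb := hmono self_mem_Ici (show a + 2 * p ∈ Ici a from by simp [hp]) (by linarith)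
  simp only at hb
  obtain ⟨y, hy, hyp⟩ := intermediate_value_Icc (show 0 ≤ a + 2 * p by linarith)
    ((h.continuousOn_stream hx).mono fun y hy => hy.1)
    (show p ∈ Icc (stream u x 0) (stream u x (a + 2 * p)) from
      ⟨by simpa using hp, by linarith [h.stream_nonneg h0 hx ha0]⟩)
  exact ⟨y, hy.1, hyp⟩

theorem level_nonneg (h : IsProfile L M u v ux uy uyy) (h0 : ∀ y > 0, 0 < u 0 y) {x p : ℝ}
    (hx : x ∈ Icc 0 L) (hp : 0 ≤ p) : 0 ≤ level u x p :=
  Function.invFunOn_mem (h.exists_stream_eq h0 hx hp)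

theorem stream_level (h : IsProfile L M u v ux uy uyy) (h0 : ∀ y > 0, 0 < u 0 y) {x p : ℝ}
    (hx : x ∈ Icc 0 L) (hp : 0 ≤ p) : stream u x (level u x p) = p :=
  Function.invFunOn_eq (h.exists_stream_eq h0 hx hp)

theorem level_stream (h : IsProfile L M u v ux uy uyy) (h0 : ∀ y > 0, 0 < u 0 y) {x y : ℝ}
    (hx : x ∈ Icc 0 L) (hy : 0 ≤ y) : level u x (stream u x y) = y :=
  have hp := h.stream_nonneg h0 hx hy
  (h.strictMonoOn_stream h0 hx).injOn (h.level_nonneg h0 hx hp) hy (h.stream_level h0 hx hp)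

theorem lt_level_iff (h : IsProfile L M u v ux uy uyy) (h0 : ∀ y > 0, 0 < u 0 y) {x y p : ℝ}
    (hx : x ∈ Icc 0 L) (hy : 0 ≤ y) (hp : 0 ≤ p) : y < level u x p ↔ stream u x y < p := by
  rw [← (h.strictMonoOn_stream h0 hx).lt_iff_lt hy (h.level_nonneg h0 hx hp),
    h.stream_level h0 hx hp]

theorem level_lt_iff (h : IsProfile L M u v ux uy uyy) (h0 : ∀ y > 0, 0 < u 0 y) {x y p : ℝ}
    (hx : x ∈ Icc 0 L) (hy : 0 ≤ y) (hp : 0 ≤ p) : level u x p < y ↔ p < stream u x y := by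
  rw [← (h.strictMonoOn_stream h0 hx).lt_iff_lt (h.level_nonneg h0 hx hp) hy,
    h.stream_level h0 hx hp]

theorem level_pos (h : IsProfile L M u v ux uy uyy) (h0 : ∀ y > 0, 0 < u 0 y) {x p : ℝ}
    (hx : x ∈ Icc 0 L) (hp : 0 < p) : 0 < level u x p := by
  rw [h.lt_level_iff h0 hx le_rfl hp.le]; simpa

theorem level_zero (h : IsProfile L M u v ux uy uyy) (h0 : ∀ y > 0, 0 < u 0 y) {x : ℝ}
    (hx : x ∈ Icc 0 L) : level u x 0 = 0 := by
  simpa using h.level_stream h0 hx le_rfl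

/-- Whether the level lies above or below a height `a` is decided by the sign of `stream u x a - p`,
which is continuous in `(x, p)`. -/
theorem continuousOn_uncurry_level (h : IsProfile L M u v ux uy uyy)
    (h0 : ∀ y > 0, 0 < u 0 y) :
    ContinuousOn (Function.uncurry (level u)) (Icc 0 L ×ˢ Ici 0) := by
  rintro ⟨x, p⟩ ⟨hx, hp⟩
  simp only at hx hp
  have hstream : ∀ a ∈ Ici (0 : ℝ), Tendsto (fun z : ℝ × ℝ => stream u z.1 a - z.2)
      (𝓝[Icc 0 L ×ˢ Ici 0] (x, p)) (𝓝 (stream u x a - p)) := by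
    intro a ha
    refine Tendsto.sub ?_ continuousWithinAt_snd
    refine (h.continuousOn_uncurry_stream (x, a) ⟨hx, ha⟩).tendsto.comp
      (f := fun z : ℝ × ℝ => (z.1, a)) ?_
    have : ContinuousWithinAt (fun z : ℝ × ℝ => (z.1, a)) (Icc 0 L ×ˢ Ici 0) (x, p) := by
      fun_prop
    exact this.tendsto_nhdsWithin fun z hz => ⟨hz.1, ha⟩
  refine tendsto_order.2 ⟨fun a ha => ?_, fun a ha => ?_⟩
  · rcases lt_or_ge a 0 with ha0 | ha0
    · filter_upwards [self_mem_nhdsWithin] with z hz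
      exact ha0.trans_le (h.level_nonneg h0 hz.1 hz.2)
    · have hlt : stream u x a - p < 0 := sub_neg.2 ((h.lt_level_iff h0 hx ha0 hp).1 ha)
      filter_upwards [self_mem_nhdsWithin, (hstream a ha0).eventually_lt_const hlt] with z hz hz'
      exact (h.lt_level_iff h0 hz.1 ha0 hz.2).2 (sub_neg.1 hz')
  · have ha0 : 0 ≤ a := (h.level_nonneg h0 hx hp).trans (le_of_lt ha)
    have hlt : 0 < stream u x a - p := sub_pos.2 ((h.level_lt_iff h0 hx ha0 hp).1 ha)
    filter_upwards [self_mem_nhdsWithin, (hstream a ha0).eventually_const_lt hlt] with z hz hz'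
    exact (h.level_lt_iff h0 hz.1 ha0 hz.2).2 (sub_pos.1 hz')

theorem exists_le_level (h : IsProfile L M u v ux uy uyy) (h0 : ∀ y > 0, 0 < u 0 y) {R : ℝ}
    (hR : 0 ≤ R) : ∃ P ≥ 0, ∀ x ∈ Icc 0 L, ∀ p ≥ P, R ≤ level u x p := by
  have hc : ContinuousOn (fun x => stream u x R) (Icc 0 L) :=
    h.continuousOn_uncurry_stream.comp (f := fun x : ℝ => (x, R)) (by fun_prop)
      fun x hx => ⟨hx, hR⟩
  obtain ⟨B, hB⟩ := isCompact_Icc.bddAbove_image hc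
  refine ⟨max B 0, le_max_right _ _, fun x hx p hp => ?_⟩
  have hp0 : 0 ≤ p := (le_max_right B 0).trans hp
  have hle : stream u x R ≤ p := (hB (mem_image_of_mem _ hx)).trans ((le_max_left B 0).trans hp)
  by_contra! hlt
  exact absurd ((h.level_lt_iff h0 hx hR hp0).1 hlt) hle.not_gt

/-- Differentiation under the integral is dominated by `M`; incompressibility and `v = 0` at the
wall then evaluate `∫ u_x` as `-v`. -/
theorem hasDerivAt_stream_x (h : IsProfile L M u v ux uy uyy) {x y : ℝ} (hx : x ∈ Ioo 0 L)
    (hy : 0 ≤ y) : HasDerivAt (fun s => stream u s y) (-v x y) x := by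
  have hxI := Ioo_subset_Icc_self hx
  have hcx : ContinuousOn (ux x) (Icc 0 y) :=
    h.cont_ux.comp (f := fun y : ℝ => (x, y)) (by fun_prop) fun y hy => ⟨hxI, hy.1⟩
  have hint : IntervalIntegrable (ux x) volume 0 y := by
    refine ContinuousOn.intervalIntegrable ?_
    rwa [uIcc_of_le hy]
  have hval : ∫ s in (0 : ℝ)..y, ux x s = -v x y := by
    have := intervalIntegral.integral_eq_sub_of_hasDerivAt_of_le hy (f := fun s => -v x s)
      (f' := ux x) (fun s hs => ((h.deriv_v x hxI s hs.1).continuousWithinAt.mono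
        fun s hs => hs.1).neg) (fun s hs =>
          ((h.deriv_v x hxI s hs.1.le).hasDerivAt (Ici_mem_nhds hs.1)).neg.congr_deriv
            (neg_neg _)) hint
    rw [this, h.v_zero x hxI]; simp
  rw [← hval]
  have hmem := Ioo_mem_nhds hx.1 hx.2
  refine (intervalIntegral.hasDerivAt_integral_of_dominated_loc_of_deriv_le
    (F := fun s t => u s t) (F' := ux) (bound := fun _ => M) hmem ?_
    (h.intervalIntegrable hxI le_rfl hy) hint.def'.aestronglyMeasurable ?_ (by simp) ?_).2
  · filter_upwards [hmem] with s hs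
    exact (h.intervalIntegrable (Ioo_subset_Icc_self hs) le_rfl hy).def'.aestronglyMeasurable
  · refine Eventually.of_forall fun t ht s hs => ?_
    rw [uIoc_of_le hy] at ht
    exact h.abs_ux_le s (Ioo_subset_Icc_self hs) t ht.1.le
  · refine Eventually.of_forall fun t ht s hs => ?_
    rw [uIoc_of_le hy] at ht
    exact h.hasDerivAt_x hs ht.1.le

theorem strip_mem_nhds {x y : ℝ} (hx : x ∈ Ioo 0 L) (hy : 0 < y) :
    Ioo 0 L ×ˢ Ioi 0 ∈ 𝓝 (x, y) :=
  prod_mem_nhds (Ioo_mem_nhds hx.1 hx.2) (Ioi_mem_nhds hy)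

theorem continuousAt_of_strip {f : ℝ × ℝ → ℝ} (hf : ContinuousOn f (Icc 0 L ×ˢ Ici 0)) {x y : ℝ}
    (hx : x ∈ Ioo 0 L) (hy : 0 < y) : ContinuousAt f (x, y) :=
  hf.continuousAt (mem_of_superset (strip_mem_nhds hx hy)
    (prod_mono Ioo_subset_Icc_self Ioi_subset_Ici_self))

/-- Differentiating `stream u s (level u s p) = p` in `s` gives `-v + u ∂_x level = 0`. -/
theorem hasDerivAt_level_x (h : IsProfile L M u v ux uy uyy) (h0 : ∀ y > 0, 0 < u 0 y)
    {x p : ℝ} (hx : x ∈ Ioo 0 L) (hp : 0 < p) :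
    HasDerivAt (fun s => level u s p) (v x (level u x p) / u x (level u x p)) x := by
  have hxI := Ioo_subset_Icc_self hx
  have hY := h.level_pos h0 hxI hp
  have hu := h.pos h0 hxI hY
  have df₁ : ∀ᶠ z : ℝ × ℝ in 𝓝 (x, level u x p),
      HasDerivAt (fun s => stream u s z.2) (-v z.1 z.2) z.1 := by
    filter_upwards [strip_mem_nhds hx hY] with z hz
    exact h.hasDerivAt_stream_x hz.1 (le_of_lt hz.2)
  have df₂ : ∀ᶠ z : ℝ × ℝ in 𝓝 (x, level u x p),
      HasDerivAt (stream u z.1) (u z.1 z.2) z.2 := by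
    filter_upwards [strip_mem_nhds hx hY] with z hz
    exact h.hasDerivAt_stream (Ioo_subset_Icc_self hz.1) hz.2
  have cf₁ := (continuousAt_of_strip h.cont_v hx hY).neg
  have cf₂ := continuousAt_of_strip h.cont_u hx hY
  have hcont : ContinuousAt (fun s => level u s p) x :=
    (continuousAt_of_strip (h.continuousOn_uncurry_level h0) hx hp).comp
      (f := fun s : ℝ => (s, p)) (by fun_prop)
  have hconst : ∀ᶠ s in 𝓝 x, stream u s (level u s p) = p := by
    filter_upwards [Icc_mem_nhds hx.1 hx.2] with s hs
    exact h.stream_level h0 hs hp.le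
  have hd := (differentiableAt_of_partials (f₁ := fun x y => -v x y) (f₂ := u)
    (g := fun s => level u s p) df₁ df₂ cf₁ cf₂ hu.ne' hcont hconst).hasDerivAt
  have h1 := hasDerivAt_comp_of_partials (f₁ := fun x y => -v x y) (f₂ := u)
    (g := fun s => level u s p) df₁ df₂ cf₁ cf₂ hd
  have h2 := (h1.congr_of_eventuallyEq (hconst.mono fun s hs => hs.symm)).unique
    (hasDerivAt_const x p)
  refine hd.congr_deriv ?_
  rw [eq_div_iff hu.ne']
  linarith

theorem hasDerivAt_level (h : IsProfile L M u v ux uy uyy) (h0 : ∀ y > 0, 0 < u 0 y)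
    {x p : ℝ} (hx : x ∈ Icc 0 L) (hp : 0 < p) :
    HasDerivAt (level u x) (u x (level u x p))⁻¹ p := by
  have hY := h.level_pos h0 hx hp
  have hcont : ContinuousOn (level u x) (Ici 0) :=
    (h.continuousOn_uncurry_level h0).comp (f := fun p : ℝ => (x, p)) (by fun_prop)
      fun p hp => ⟨hx, hp⟩
  refine (h.hasDerivAt_stream hx hY).of_local_left_inverse
    (hcont.continuousAt (Ici_mem_nhds hp)) (h.pos h0 hx hY).ne' ?_
  filter_upwards [Ici_mem_nhds hp] with q hq
  exact h.stream_level h0 hx hq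

/-- The von Mises transform of the square of the velocity is jointly continuous. -/
theorem continuousOn_sq_level (h : IsProfile L M u v ux uy uyy) (h0 : ∀ y > 0, 0 < u 0 y) :
    ContinuousOn (Function.uncurry fun x p => u x (level u x p) ^ 2) (Icc 0 L ×ˢ Ici 0) :=
  (h.cont_u.comp (f := fun z : ℝ × ℝ => (z.1, level u z.1 z.2))
    (continuousOn_fst.prodMk (h.continuousOn_uncurry_level h0))
    fun _ hz => ⟨hz.1, h.level_nonneg h0 hz.1 hz.2⟩).pow 2

/-- At fixed `p` the derivative is `2u (u_x + u_y v / u)`, twice the advection term, which the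
momentum equation replaces by `u_yy - u + 1`. -/
theorem hasDerivAt_sq_level_x (h : IsProfile L M u v ux uy uyy) (h0 : ∀ y > 0, 0 < u 0 y)
    {x p : ℝ} (hx : x ∈ Ioo 0 L) (hp : 0 < p) :
    HasDerivAt (fun s => u s (level u s p) ^ 2)
      (2 * (uyy x (level u x p) - u x (level u x p) + 1)) x := by
  have hxI := Ioo_subset_Icc_self hx
  have hY := h.level_pos h0 hxI hp
  have hu := h.pos h0 hxI hY
  have hd := (hasDerivAt_comp_of_partials (f := u) (f₁ := ux) (f₂ := uy)
    (g := fun s => level u s p) (by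
      filter_upwards [strip_mem_nhds hx hY] with z hz
      exact h.hasDerivAt_x hz.1 (le_of_lt hz.2)) (by
      filter_upwards [strip_mem_nhds hx hY] with z hz
      exact h.hasDerivAt_y (Ioo_subset_Icc_self hz.1) hz.2)
    (continuousAt_of_strip h.cont_ux hx hY) (continuousAt_of_strip h.cont_uy hx hY)
    (h.hasDerivAt_level_x h0 hx hp)).pow 2
  refine hd.congr_deriv ?_
  have := h.momentum x hxI _ hY.le
  field_simp
  push_cast
  linear_combination (2 * u x (level u x p)) * this

theorem hasDerivAt_sq_level (h : IsProfile L M u v ux uy uyy) (h0 : ∀ y > 0, 0 < u 0 y)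
    {x p : ℝ} (hx : x ∈ Icc 0 L) (hp : 0 < p) :
    HasDerivAt (fun q => u x (level u x q) ^ 2) (2 * uy x (level u x p)) p := by
  have hY := h.level_pos h0 hx hp
  have hu := h.pos h0 hx hY
  have hd := ((h.hasDerivAt_y hx hY).comp p (h.hasDerivAt_level h0 hx hp)).pow 2
  refine hd.congr_deriv ?_
  simp only [Function.comp]
  field_simp
  norm_num
  ring

/-- This is `w_pp` for `w = u²`, so that `√w w_pp = 2 u_yy` closes the scalar equation. -/
theorem hasDerivAt_uy_level (h : IsProfile L M u v ux uy uyy) (h0 : ∀ y > 0, 0 < u 0 y)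
    {x p : ℝ} (hx : x ∈ Icc 0 L) (hp : 0 < p) :
    HasDerivAt (fun q => 2 * uy x (level u x q))
      (2 * (uyy x (level u x p) / u x (level u x p))) p :=
  ((h.hasDerivAt_yy hx (h.level_pos h0 hx hp)).comp p (h.hasDerivAt_level h0 hx hp)).const_mul 2

end IsProfile

/-! ### Comparison and uniqueness. -/

namespace IsProfile

variable {L M : ℝ} {u₁ v₁ ux₁ uy₁ uyy₁ u₂ v₂ ux₂ uy₂ uyy₂ : ℝ → ℝ → ℝ}

theorem sq_level_far_field {u v ux uy uyy : ℝ → ℝ → ℝ} (h : IsProfile L M u v ux uy uyy)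
    (h0 : ∀ y > 0, 0 < u 0 y) {ε : ℝ} (hε : 0 < ε) :
    ∃ P ≥ 0, ∀ x ∈ Icc 0 L, ∀ p ≥ P, |u x (level u x p) ^ 2 - 1| ≤ ε := by
  -- The cap `1` gives `|w + 1| ≤ 3`, and `ε / 3` absorbs this factor.
  have hδ : 0 < min (ε / 3) 1 := by positivity
  obtain ⟨R, hR0, hR⟩ := h.uniform_far_field hδ
  obtain ⟨P, hP0, hP⟩ := h.exists_le_level h0 hR0
  refine ⟨P, hP0, fun x hx p hp => ?_⟩
  have h1 := hR x hx _ (hP x hx p hp)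
  have h2 := h1.trans (min_le_left _ _)
  have h3 := abs_le.1 (h1.trans (min_le_right _ _))
  set w := u x (level u x p)
  have h4 : |w + 1| ≤ 3 := abs_le.2 ⟨by linarith, by linarith⟩
  calc |w ^ 2 - 1| = |w - 1| * |w + 1| := by rw [← abs_mul]; ring_nf
    _ ≤ ε / 3 * 3 := mul_le_mul h2 h4 (abs_nonneg _) (by positivity)
    _ = ε := by ring

theorem level_init_eq (h₁ : IsProfile L M u₁ v₁ ux₁ uy₁ uyy₁)
    (h₂ : IsProfile L M u₂ v₂ ux₂ uy₂ uyy₂) (h01 : ∀ y > 0, 0 < u₁ 0 y)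
    (hinit : ∀ y ∈ Ici (0 : ℝ), u₁ 0 y = u₂ 0 y) (hL : 0 ≤ L) {p : ℝ} (hp : 0 ≤ p) :
    level u₁ 0 p = level u₂ 0 p := by
  have hx : (0 : ℝ) ∈ Icc 0 L := left_mem_Icc.2 hL
  have h02 : ∀ y > 0, 0 < u₂ 0 y := fun y hy => by rw [← hinit y (le_of_lt hy)]; exact h01 y hy
  have hY := h₁.level_nonneg h01 hx hp
  have hs : stream u₂ 0 (level u₁ 0 p) = p := by
    refine (intervalIntegral.integral_congr fun s hs => ?_).trans (h₁.stream_level h01 hx hp)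
    rw [uIcc_of_le hY] at hs
    exact (hinit s hs.1).symm
  rw [← h₂.level_stream h02 hx hY, hs]

/-- Comparison in von Mises variables. -/
theorem sq_level_sub_nonpos (h₁ : IsProfile L M u₁ v₁ ux₁ uy₁ uyy₁)
    (h₂ : IsProfile L M u₂ v₂ ux₂ uy₂ uyy₂) (h01 : ∀ y > 0, 0 < u₁ 0 y)
    (hinit : ∀ y ∈ Ici (0 : ℝ), u₁ 0 y = u₂ 0 y) (hL : 0 ≤ L) {T : ℝ} (hT : T < L) :
    ∀ x ∈ Icc 0 T, ∀ p ∈ Ici (0 : ℝ),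
      u₁ x (level u₁ x p) ^ 2 - u₂ x (level u₂ x p) ^ 2 ≤ 0 := by
  have h02 : ∀ y > 0, 0 < u₂ 0 y := fun y hy => by rw [← hinit y (le_of_lt hy)]; exact h01 y hy
  obtain ⟨K, hK0, hK⟩ := h₂.exists_uyy_sub_le h02
  have hsub : Icc 0 T ⊆ Icc 0 L := Icc_subset_Icc_right hT.le
  refine nonpos_of_parabolic (K := 2 * K)
    (W := fun x p => u₁ x (level u₁ x p) ^ 2 - u₂ x (level u₂ x p) ^ 2)
    (((h₁.continuousOn_sq_level h01).sub (h₂.continuousOn_sq_level h02)).mono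
      (prod_mono_left hsub)) ?_ ?_ ?_ (by positivity) ?_
  · intro p hp
    have hlev := h₁.level_init_eq h₂ h01 hinit hL hp
    have := hinit _ (h₁.level_nonneg h01 (left_mem_Icc.2 hL) hp)
    rw [← hlev, this, sub_self]
  · intro x hx
    rw [h₁.level_zero h01 (hsub hx), h₂.level_zero h02 (hsub hx), h₁.u_zero x (hsub hx),
      h₂.u_zero x (hsub hx), sub_self]
  · intro ε hε
    obtain ⟨P, -, hP⟩ := h₁.sq_level_far_field h01 (half_pos hε)
    obtain ⟨P', -, hP'⟩ := h₂.sq_level_far_field h02 (half_pos hε)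
    refine ⟨max P P', fun x hx p hp => ?_⟩
    have a1 := abs_le.1 (hP x (hsub hx) p ((le_max_left _ _).trans hp))
    have a2 := abs_le.1 (hP' x (hsub hx) p ((le_max_right _ _).trans hp))
    linarith
  · intro x hx p hp hW
    have hxI : x ∈ Icc 0 L := hsub (Ioc_subset_Icc_self hx)
    -- The strict inequality `T < L` makes the `x`-derivatives two-sided, even at `x = T`.
    have hxo : x ∈ Ioo 0 L := ⟨hx.1, hx.2.trans_lt hT⟩
    have hu₁ := h₁.pos h01 hxI (h₁.level_pos h01 hxI hp)
    have hu₂ := h₂.pos h02 hxI (h₂.level_pos h02 hxI hp)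
    refine ⟨_, u₁ x (level u₁ x p), _, _,
      (h₁.hasDerivAt_sq_level_x h01 hxo hp).sub (h₂.hasDerivAt_sq_level_x h02 hxo hp), ?_,
      (h₁.hasDerivAt_uy_level h01 hxI hp).sub (h₂.hasDerivAt_uy_level h02 hxI hp), hu₁.le, ?_⟩
    · filter_upwards [Ioi_mem_nhds hp] with q hq
      exact (h₁.hasDerivAt_sq_level h01 hxI hq).sub (h₂.hasDerivAt_sq_level h02 hxI hq)
    · have hk := hK x hxI _ (h₂.level_nonneg h02 hxI (le_of_lt hp))
      set a := u₁ x (level u₁ x p)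
      set b := u₂ x (level u₂ x p)
      set c := uyy₁ x (level u₁ x p)
      set d := uyy₂ x (level u₂ x p)
      have hab : b < a := lt_of_pow_lt_pow_left₀ 2 hu₁.le (by linarith)
      have hdb : (d - b) / b ≤ K * b := by
        rw [div_le_iff₀ hu₂]; linarith
      have hprod : (a - b) * ((d - b) / b) ≤ (a - b) * (K * b) :=
        mul_le_mul_of_nonneg_left hdb (by linarith)
      have hle : (a - b) * (K * b) ≤ K * (a ^ 2 - b ^ 2) := by
        have : 0 ≤ K * ((a - b) * a) :=
          mul_nonneg hK0 (mul_nonneg (by linarith) hu₁.le)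
        linarith
      -- With the diffusion coefficient `a` factored out, the remainder is of zeroth order; as `a >
      -- b`, an upper bound on `(d - b) / b` is enough to control it.
      have hid : 2 * (c - a + 1) - 2 * (d - b + 1) =
          a * (2 * (c / a) - 2 * (d / b)) + 2 * ((a - b) * ((d - b) / b)) := by
        field_simp
        ring
      rw [hid]
      linarith

/-- Both heights vanish at `p = 0` and have the same `p`-derivative `1/u`. -/
theorem level_eq (h₁ : IsProfile L M u₁ v₁ ux₁ uy₁ uyy₁)
    (h₂ : IsProfile L M u₂ v₂ ux₂ uy₂ uyy₂) (h01 : ∀ y > 0, 0 < u₁ 0 y)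
    (h02 : ∀ y > 0, 0 < u₂ 0 y) {x : ℝ} (hx : x ∈ Icc 0 L)
    (hu : ∀ p ∈ Ici (0 : ℝ), u₁ x (level u₁ x p) = u₂ x (level u₂ x p)) {p : ℝ} (hp : 0 < p) :
    level u₁ x p = level u₂ x p := by
  have hc : ContinuousOn (fun q => level u₁ x q - level u₂ x q) (Icc 0 p) :=
    ((h₁.continuousOn_uncurry_level h01).comp (f := fun q : ℝ => (x, q)) (by fun_prop)
      fun _ hq => ⟨hx, hq.1⟩).sub
    ((h₂.continuousOn_uncurry_level h02).comp (f := fun q : ℝ => (x, q)) (by fun_prop)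
      fun _ hq => ⟨hx, hq.1⟩)
  obtain ⟨c, -, hc⟩ := exists_hasDerivAt_eq_slope _ (fun _ => (0 : ℝ)) hp hc fun q hq =>
    ((h₁.hasDerivAt_level h01 hx hq.1).sub (h₂.hasDerivAt_level h02 hx hq.1)).congr_deriv (by
      rw [hu q hq.1.le, sub_self])
  rw [h₁.level_zero h01 hx, h₂.level_zero h02 hx, eq_comm, div_eq_zero_iff] at hc
  rcases hc with hc | hc <;> linarith

/-- Two profiles with the same positive initial velocity coincide. -/
theorem unique (h₁ : IsProfile L M u₁ v₁ ux₁ uy₁ uyy₁)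
    (h₂ : IsProfile L M u₂ v₂ ux₂ uy₂ uyy₂) (h01 : ∀ y > 0, 0 < u₁ 0 y)
    (hinit : ∀ y ∈ Ici (0 : ℝ), u₁ 0 y = u₂ 0 y) (hL : 0 < L) :
    ∀ x ∈ Icc 0 L, ∀ y ∈ Ici (0 : ℝ), u₁ x y = u₂ x y ∧ v₁ x y = v₂ x y := by
  have h02 : ∀ y > 0, 0 < u₂ 0 y := fun y hy => by rw [← hinit y (le_of_lt hy)]; exact h01 y hy
  have hlt : ∀ x ∈ Ico 0 L, ∀ y ∈ Ici (0 : ℝ), u₁ x y = u₂ x y := by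
    intro x hx y hy
    have hxI := Ico_subset_Icc_self hx
    have hu : ∀ p ∈ Ici (0 : ℝ), u₁ x (level u₁ x p) = u₂ x (level u₂ x p) := by
      intro p hp
      have a := h₁.sq_level_sub_nonpos h₂ h01 hinit hL.le hx.2 x ⟨hx.1, le_rfl⟩ p hp
      have b := h₂.sq_level_sub_nonpos h₁ h02 (fun y hy => (hinit y hy).symm) hL.le hx.2 x
        ⟨hx.1, le_rfl⟩ p hp
      rcases (mem_Ici.1 hp).lt_or_eq with hp0 | hp0
      · exact (pow_left_inj₀ (h₁.pos h01 hxI (h₁.level_pos h01 hxI hp0)).le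
          (h₂.pos h02 hxI (h₂.level_pos h02 hxI hp0)).le two_ne_zero).1 (by linarith)
      · rw [← hp0, h₁.level_zero h01 hxI, h₂.level_zero h02 hxI, h₁.u_zero x hxI,
          h₂.u_zero x hxI]
    rcases (mem_Ici.1 hy).lt_or_eq with hy0 | hy0
    · have hp : 0 < stream u₁ x y := by
        simpa using h₁.strictMonoOn_stream h01 hxI self_mem_Ici hy hy0
      have hlev := h₁.level_eq h₂ h01 h02 hxI hu hp
      have := hu _ hp.le
      rwa [← hlev, h₁.level_stream h01 hxI hy] at this
    · rw [← hy0, h₁.u_zero x hxI, h₂.u_zero x hxI]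
  -- The comparison stops short of `x = L`, which is reached by continuity.
  have hu : ∀ y ∈ Ici (0 : ℝ), EqOn (fun x => u₁ x y) (fun x => u₂ x y) (Icc 0 L) := by
    intro y hy
    have heq : EqOn (fun x => u₁ x y) (fun x => u₂ x y) (Ico 0 L) := fun x hx => hlt x hx y hy
    refine heq.of_subset_closure (fun x hx => (h₁.deriv_x x hx y hy).continuousWithinAt)
      (fun x hx => (h₂.deriv_x x hx y hy).continuousWithinAt) Ico_subset_Icc_self ?_
    rw [closure_Ico hL.ne]
  intro x hx y hy
  refine ⟨hu y hy hx, ?_⟩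
  -- Equal `u` gives equal `u_x`, hence equal `∂_y v`, and the wall condition fixes `v`.
  have hux : ∀ z ∈ Ici (0 : ℝ), ux₁ x z = ux₂ x z := fun z hz =>
    (uniqueDiffOn_Icc hL x hx).eq_deriv _ (h₁.deriv_x x hx z hz)
      ((h₂.deriv_x x hx z hz).congr (fun s hs => hu z hz hs) (hu z hz hx))
  rcases (mem_Ici.1 hy).lt_or_eq with hy0 | hy0
  · obtain ⟨c, -, hc⟩ := exists_hasDerivAt_eq_slope (fun z => v₁ x z - v₂ x z) (fun _ => (0 : ℝ))
      hy0 (fun z hz => ((h₁.deriv_v x hx z hz.1).sub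
        (h₂.deriv_v x hx z hz.1)).continuousWithinAt.mono fun z hz => hz.1) fun z hz =>
      (((h₁.deriv_v x hx z hz.1.le).sub (h₂.deriv_v x hx z hz.1.le)).hasDerivAt
        (Ici_mem_nhds hz.1)).congr_deriv (by rw [hux z hz.1.le, sub_self])
    rw [h₁.v_zero x hx, h₂.v_zero x hx, eq_comm, div_eq_zero_iff] at hc
    rcases hc with hc | hc <;> linarith
  · rw [← hy0, h₁.v_zero x hx, h₂.v_zero x hx]

end IsProfile

/-! ### From the regularity estimate to the theorem. -/

theorem one_le_japanese (y : ℝ) : 1 ≤ japanese y := by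
  rw [japanese, Real.one_le_sqrt]
  linarith [sq_nonneg y]

theorem abs_le_of_weightedSup_le {L l C : ℝ} {f : ℝ → ℝ → ℝ} (hl : 0 ≤ l)
    (hf : weightedSup L l f ≤ ENNReal.ofReal C) {x y : ℝ} (hx : x ∈ Icc 0 L)
    (hy : y ∈ Ici (0 : ℝ)) : |f x y| ≤ max C 0 := by
  have h1 : ENNReal.ofReal (|f x y| * japanese y ^ l) ≤ ENNReal.ofReal C :=
    (le_iSup₂_of_le (f := fun x (_ : x ∈ Icc 0 L) => ⨆ y ∈ Ici (0 : ℝ),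
      ENNReal.ofReal (|f x y| * japanese y ^ l)) x hx
      (le_iSup₂ (f := fun y (_ : y ∈ Ici (0 : ℝ)) =>
        ENNReal.ofReal (|f x y| * japanese y ^ l)) y hy)).trans hf
  have h2 : |f x y| ≤ |f x y| * japanese y ^ l :=
    le_mul_of_one_le_right (abs_nonneg _) (Real.one_le_rpow (one_le_japanese y) hl)
  rw [ENNReal.ofReal_le_ofReal_iff'] at h1
  rcases h1 with h1 | h1
  · exact h2.trans (h1.trans (le_max_left _ _))
  · exact h2.trans (h1.trans (le_max_right _ _))

theorem IsSolution.isProfile {k : ℕ} (hk : 2 ≤ k) {l L C₀ : ℝ} (hl : 0 ≤ l)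
    {u₀ : ℝ → ℝ} {u v : ℝ → ℝ → ℝ} (h : IsSolution k L u₀ u v)
    (hreg : RegularityEstimate k l L C₀ u v) :
    IsProfile L (max C₀ 0) u v (pd L 1 0 u) (pd L 0 1 u) (pd L 0 2 u) where
  cont_u := h.regular_u.cont 0 0 (by omega)
  cont_v := h.regular_v.cont 0 0 (by omega)
  cont_ux := h.regular_u.cont 1 0 (by omega)
  cont_uy := h.regular_u.cont 0 1 (by omega)
  cont_uyy := h.regular_u.cont 0 2 (by omega)
  deriv_x := h.regular_u.hasDerivX 0 0 (by omega)
  deriv_y := h.regular_u.hasDerivY 0 0 (by omega)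
  deriv_yy := h.regular_u.hasDerivY 0 1 (by omega)
  deriv_v x hx y hy := (h.regular_v.hasDerivY 0 0 (by omega) x hx y hy).congr_deriv (by
    linarith [h.divergence_free x hx y hy])
  momentum := h.momentum
  u_zero x hx := (h.no_slip x hx).1
  v_zero x hx := (h.no_slip x hx).2
  far_field := h.far_field
  nonneg_bound := le_max_right _ _
  abs_ux_le x hx y hy := abs_le_of_weightedSup_le hl
    ((le_self_add.trans le_self_add).trans
      (hreg 1 0 0 (by omega) (by omega) (by omega))) hx hy
  abs_uyy_le x hx y hy := abs_le_of_weightedSup_le hl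
    ((le_self_add.trans le_self_add).trans
      (hreg 0 2 0 (by omega) (by omega) (by omega))) hx hy

/-- A function vanishing on `y ≥ 0` has vanishing one-sided `y`-derivatives of every order there. -/
theorem dY_iterate_eq_zero {f : ℝ → ℝ → ℝ} {x : ℝ} (hf : ∀ y ∈ Ici (0 : ℝ), f x y = 0) (n : ℕ) :
    ∀ y ∈ Ici (0 : ℝ), dY^[n] f x y = 0 := by
  induction n with
  | zero => exact hf
  | succ n ih =>
    intro y hy
    rw [Function.iterate_succ_apply', dY, derivWithin_congr (f := fun _ => (0 : ℝ)) ih (ih y hy)]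
    simp

theorem sqNorm_eq_zero {f : ℝ → ℝ} (hf : ∀ y > 0, f y = 0) : sqNorm f = 0 := by
  have : f =ᵐ[volume.restrict (Ioi 0)] 0 := by
    filter_upwards [ae_restrict_mem measurableSet_Ioi] with y hy
    exact hf y hy
  rw [sqNorm, eLpNorm_congr_ae this]
  simp

end PrandtlHartmann

open PrandtlHartmann in
theorem proposition3p4 (k : ℕ) (hk : 2 ≤ k) (l : ℝ) (hl : 1 ≤ l) (L : ℝ) (hL : 0 < L) (C₀ : ℝ)
    (u₀ : ℝ → ℝ) (hu₀_pos : ∀ y : ℝ, 0 < y → 0 < u₀ y)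
    (hu₀_deriv : 0 < derivWithin u₀ (Set.Ici 0) 0) :
    ∃ C : ℝ, 0 < C ∧
      ∀ u₁ v₁ u₂ v₂ : ℝ → ℝ → ℝ,
        IsSolution k L u₀ u₁ v₁ → RegularityEstimate k l L C₀ u₁ v₁ →
        IsSolution k L u₀ u₂ v₂ → RegularityEstimate k l L C₀ u₂ v₂ →
        -- the quotient is well defined in the fluid domain
        (∀ x ∈ Set.Icc 0 L, ∀ y : ℝ, 0 < y → 0 < u₂ x y) ∧
        -- the energy inequality between finite quantities
        (∀ x ∈ Set.Ioc 0 L,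
          sqNorm (fun y => u₂ x y * dY (quotient v₁ u₂ v₂) x y)
              + (∫⁻ τ in Set.Ioc 0 x,
                  sqNorm (fun y => √(u₂ τ y) * dY^[2] (quotient v₁ u₂ v₂) τ y))
              + (∫⁻ τ in Set.Ioc 0 x,
                  sqNorm (fun y => √(u₂ τ y) * dY (quotient v₁ u₂ v₂) τ y))
            ≤ ENNReal.ofReal C * ∫⁻ τ in Set.Ioc 0 x,
                  sqNorm (fun y => u₂ τ y * dY (quotient v₁ u₂ v₂) τ y) ∧
          (∫⁻ τ in Set.Ioc 0 x,
                  sqNorm (fun y => u₂ τ y * dY (quotient v₁ u₂ v₂) τ y)) < ⊤) ∧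
        -- uniqueness
        (∀ x ∈ Set.Icc 0 L, ∀ y ∈ Set.Ici (0 : ℝ), u₁ x y = u₂ x y ∧ v₁ x y = v₂ x y) := by
  -- Uniqueness makes every norm in the inequality zero, so any positive constant serves.
  refine ⟨1, one_pos, fun u₁ v₁ u₂ v₂ hs₁ hr₁ hs₂ hr₂ => ?_⟩
  have h₁ := hs₁.isProfile hk (zero_le_one.trans hl) hr₁
  have h₂ := hs₂.isProfile hk (zero_le_one.trans hl) hr₂
  have h01 : ∀ y > 0, 0 < u₁ 0 y := fun y hy => by
    rw [hs₁.initial y (le_of_lt hy)]; exact hu₀_pos y hy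
  have h02 : ∀ y > 0, 0 < u₂ 0 y := fun y hy => by
    rw [hs₂.initial y (le_of_lt hy)]; exact hu₀_pos y hy
  have huniq := h₁.unique h₂ h01
    (fun y hy => (hs₁.initial y hy).trans (hs₂.initial y hy).symm) hL
  refine ⟨fun x hx y hy => h₂.pos h02 hx hy, fun x hx => ?_, huniq⟩
  have hq : ∀ τ ∈ Set.Icc 0 L, ∀ n : ℕ, ∀ y > 0, dY^[n] (quotient v₁ u₂ v₂) τ y = 0 :=
    fun τ hτ n y hy => dY_iterate_eq_zero (fun z hz => by
      rw [quotient, (huniq τ hτ z hz).2, sub_self, zero_div]) n y (le_of_lt hy)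
  have hnorm : ∀ τ ∈ Set.Icc 0 L, ∀ (n : ℕ) (g : ℝ → ℝ),
      sqNorm (fun y => g y * dY^[n] (quotient v₁ u₂ v₂) τ y) = 0 := fun τ hτ n g =>
    sqNorm_eq_zero fun y hy => by rw [hq τ hτ n y hy, mul_zero]
  have hint : ∀ (n : ℕ) (g : ℝ → ℝ → ℝ), (∫⁻ τ in Set.Ioc 0 x,
      sqNorm (fun y => g τ y * dY^[n] (quotient v₁ u₂ v₂) τ y)) = 0 := fun n g => by
    rw [MeasureTheory.setLIntegral_congr_fun (g := fun _ => 0) measurableSet_Ioc fun τ hτ =>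
      hnorm τ ⟨hτ.1.le, hτ.2.trans hx.2⟩ n (g τ)]
    simp
  have e₀ := hnorm x (Set.Ioc_subset_Icc_self hx) 1 (u₂ x)
  have e₁ := hint 2 fun τ y => √(u₂ τ y)
  have e₂ := hint 1 fun τ y => √(u₂ τ y)
  have e₃ := hint 1 u₂
  simp only [Function.iterate_one] at e₀ e₂ e₃
  rw [e₀, e₁, e₂, e₃]
  simp
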